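/- A quadratic Lie superalgebra is a complex $\mathbb Z_2$-graded vector space $\mathfrak g=\mathfrak g_{\bar 0}\oplus\mathfrak g_{\bar 1}$ with a Lie superalgebra bracket $[\cdot,\cdot]$ and a bilinear form $B$ that is non-degenerate, even ($B(\mathfrak g_{\bar 0},\mathfrak g_{\bar 1})=B(\mathfrak g_{\bar 1},\mathfrak g_{\bar 0})=0$), supersymmetric (symmetric on $\mathfrak g_{\bar 0}$, skew-symmetric on $\mathfrak g_{\bar 1}$) and invariant ($B([X,Y],Z)=B(X,[Y,Z])$ for all $X,Y,Z\in\mathfrak g$). An isomorphism of Lie superalgebras is a degree-preserving linear isomorphism $A$ with $A([X,Y])=[A(X),A(Y)]'$ for all $X,Y$. Two quadratic Lie superalgebras $(\mathfrak g,B)$ and $(\mathfrak g',B')$ are isometrically isomorphic if there is an isomorphism of Lie superalgebras $A:\mathfrak g\to\mathfrak g'$ with $B'(A(X),A(Y))=B(X,Y)$ for all $X,Y\in\mathfrak g$. Let $n\ge 0$ and let $\mathscr S(2+2n)$ be the set of quadratic Lie superalgebra structures $([\cdot,\cdot],B)$ on the $\mathbb Z_2$-graded vector space $\mathbb C^2\oplus\mathbb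 C^{2n}$ with even part $\mathbb C^2$ and odd part $\mathbb C^{2n}$. Proposition. Let $\mathfrak g$ and $\mathfrak g'$ be elements of $\mathscr S(2+2n)$. Then $\mathfrak g$ and $\mathfrak g'$ are isometrically isomorphic if and only if they are isomorphic as Lie superalgebras. -/

import Mathlib

/-- A (complex) Lie superalgebra structure on a vector space `V` that is `ℤ/2`-graded by
`𝒱 0` (the even part) and `𝒱 1` (the odd part). -/
structure LieSuperalgebra {V : Type*} [AddCommGroup V] [Module ℂ V]
    (𝒱 : ZMod 2 → Submodule ℂ V) where
  /-- `V` is the direct sum of its even and odd parts. -/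
  isInternal : DirectSum.IsInternal 𝒱
  /-- The super-bracket, a bilinear map. -/
  bracket : V →ₗ[ℂ] V →ₗ[ℂ] V
  bracket_mem : ∀ (i j : ZMod 2), ∀ x ∈ 𝒱 i, ∀ y ∈ 𝒱 j, bracket x y ∈ 𝒱 (i + j)
  /-- Super-antisymmetry: `[x, y] = -(-1)^{|x||y|} [y, x]`. -/
  bracket_skew : ∀ (i j : ZMod 2), ∀ x ∈ 𝒱 i, ∀ y ∈ 𝒱 j,
    bracket x y = -((-1 : ℂ) ^ (i.val * j.val) • bracket y x)
  /-- Super Jacobi identity: `[x, [y, z]] = [[x, y], z] + (-1)^{|x||y|} [y, [x, z]]`. -/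
  jacobi : ∀ (i j k : ZMod 2), ∀ x ∈ 𝒱 i, ∀ y ∈ 𝒱 j, ∀ z ∈ 𝒱 k,
    bracket x (bracket y z) =
      bracket (bracket x y) z + (-1 : ℂ) ^ (i.val * j.val) • bracket y (bracket x z)

/-- A quadratic Lie superalgebra: a Lie superalgebra with a non-degenerate, even,
supersymmetric, invariant bilinear form. -/
structure QuadraticLieSuperalgebra {V : Type*} [AddCommGroup V] [Module ℂ V]
    (𝒱 : ZMod 2 → Submodule ℂ V) extends LieSuperalgebra 𝒱 where
  form : LinearMap.BilinForm ℂ V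
  form_nondegenerate : form.Nondegenerate
  form_even : ∀ (i j : ZMod 2), i ≠ j → ∀ x ∈ 𝒱 i, ∀ y ∈ 𝒱 j, form x y = 0
  form_supersymm : ∀ (i j : ZMod 2), ∀ x ∈ 𝒱 i, ∀ y ∈ 𝒱 j,
    form x y = (-1 : ℂ) ^ (i.val * j.val) * form y x
  form_invariant : ∀ x y z : V, form (bracket x y) z = form x (bracket y z)

/-- An isomorphism of Lie superalgebras: an even (i.e. degree-preserving) linear isomorphism
that respects the brackets. -/
structure LieSuperalgebra.Iso {V W : Type*} [AddCommGroup V] [Module ℂ V]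
    [AddCommGroup W] [Module ℂ W] {𝒱 : ZMod 2 → Submodule ℂ V} {𝒲 : ZMod 2 → Submodule ℂ W}
    (g : LieSuperalgebra 𝒱) (g' : LieSuperalgebra 𝒲) extends V ≃ₗ[ℂ] W where
  map_mem : ∀ (i : ZMod 2), ∀ x ∈ 𝒱 i, toLinearEquiv x ∈ 𝒲 i
  map_bracket : ∀ x y : V,
    toLinearEquiv (g.bracket x y) = g'.bracket (toLinearEquiv x) (toLinearEquiv y)

/-- `g` and `g'` are isomorphic as Lie superalgebras (the bilinear forms play no role). -/
def QuadraticLieSuperalgebra.IsIsomorphic {V W : Type*} [AddCommGroup V] [Module ℂ V]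
    [AddCommGroup W] [Module ℂ W] {𝒱 : ZMod 2 → Submodule ℂ V} {𝒲 : ZMod 2 → Submodule ℂ W}
    (g : QuadraticLieSuperalgebra 𝒱) (g' : QuadraticLieSuperalgebra 𝒲) : Prop :=
  Nonempty (LieSuperalgebra.Iso g.toLieSuperalgebra g'.toLieSuperalgebra)

/-- `g` and `g'` are isometrically isomorphic: there is an isomorphism of Lie superalgebras
that carries the bilinear form of `g` to that of `g'`. -/
def QuadraticLieSuperalgebra.IsIsometricallyIsomorphic {V W : Type*}
    [AddCommGroup V] [Module ℂ V] [AddCommGroup W] [Module ℂ W]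
    {𝒱 : ZMod 2 → Submodule ℂ V} {𝒲 : ZMod 2 → Submodule ℂ W}
    (g : QuadraticLieSuperalgebra 𝒱) (g' : QuadraticLieSuperalgebra 𝒲) : Prop :=
  ∃ A : LieSuperalgebra.Iso g.toLieSuperalgebra g'.toLieSuperalgebra,
    ∀ x y : V, g'.form (A.toLinearEquiv x) (A.toLinearEquiv y) = g.form x y

/-- The `ℤ/2`-grading of `ℂ² ⊕ ℂ²ⁿ` with even part `ℂ²` and odd part `ℂ²ⁿ`. -/
def stdGrading (n : ℕ) : ZMod 2 → Submodule ℂ ((Fin 2 → ℂ) × (Fin (2 * n) → ℂ)) := fun i =>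
  if i = 0 then LinearMap.range (LinearMap.inl ℂ (Fin 2 → ℂ) (Fin (2 * n) → ℂ))
  else LinearMap.range (LinearMap.inr ℂ (Fin 2 → ℂ) (Fin (2 * n) → ℂ))

/-- The set `𝒮(2+2n)` of quadratic Lie superalgebra structures on the `ℤ/2`-graded vector
space `ℂ² ⊕ ℂ²ⁿ`. The bilinear form is part of the structure, so two elements may carry
different forms. -/
abbrev QuadraticStructures (n : ℕ) := QuadraticLieSuperalgebra (stdGrading n)

/-!
Two invariant forms `B`, `B'` on the same Lie superalgebra are related by `B x y = B' (N x) y` for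
an even, invertible, `B'`-self-adjoint `N` in the centroid. A square root `R` of `N` that is a
polynomial in `N` (solve modulo the nilradical of `ℂ[N]`, then lift by Newton's method) is an
isometry from `B` to `B'`, but it multiplies brackets by `N`: `[R x, R y] = N [x, y]`.

If brackets of odd elements vanish, invariance forces the whole bracket to vanish, and `R` is an
automorphism. Otherwise some odd `x₀` has `X = [x₀, x₀] ≠ 0`. Because the even part has dimension at
most two, it is abelian, all brackets of odd elements lie on the isotropic line `ℂ X`, and `X` acts
trivially on the odd part. Now `N X = μ X` for a scalar `μ`; keeping `R` on the odd part and
replacing it on the even part by an isometry that sends `X` to `μ X` and is the identity modulo `X`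
gives an automorphism carrying `B` to `B'`.
-/

open LinearMap (BilinForm IsAdjointPair)

section NthRoot

variable {K : Type*} [Field K] [IsAlgClosed K] {n : ℕ}

theorem exists_isNilpotent_pow_sub {A : Type*} [CommRing A] [IsArtinianRing A] [Algebra K A]
    [Algebra.IsIntegral K A] (hn : 0 < n) (a : A) : ∃ s : A, IsNilpotent (s ^ n - a) := by
  have hroot (I : MaximalSpectrum A) :
      ∃ z : A ⧸ I.asIdeal, z ^ n = Ideal.Quotient.mk I.asIdeal a := by
    obtain ⟨c, hc⟩ := (IsAlgClosed.algebraMap_bijective_of_isIntegral (k := K)).2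
      (Ideal.Quotient.mk I.asIdeal a)
    obtain ⟨d, hd⟩ := IsAlgClosed.exists_pow_nat_eq c hn
    exact ⟨algebraMap K _ d, by rw [← map_pow, hd, hc]⟩
  choose z hz using hroot
  obtain ⟨s, hs⟩ := Ideal.Quotient.mk_surjective ((IsArtinianRing.quotNilradicalEquivPi A).symm z)
  refine ⟨s, mem_nilradical.1 (Ideal.Quotient.eq.1 ?_)⟩
  apply (IsArtinianRing.quotNilradicalEquivPi A).injective
  rw [map_pow, hs, map_pow, AlgEquiv.apply_symm_apply]
  exact funext hz

theorem exists_pow_eq_of_isUnit {A : Type*} [CommRing A] [IsArtinianRing A] [Algebra K A]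
    [Algebra.IsIntegral K A] (hn : (n : K) ≠ 0) {a : A} (ha : IsUnit a) : ∃ s : A, s ^ n = a := by
  have hn₀ : n ≠ 0 := by rintro rfl; simp at hn
  obtain ⟨s, hs⟩ := exists_isNilpotent_pow_sub (K := K) hn₀.pos a
  have hs_unit : IsUnit s := by
    rw [← isUnit_pow_iff hn₀, ← sub_add_cancel (s ^ n) a]
    exact hs.isUnit_add_right_of_commute ha (.all _ _)
  have hn_unit : IsUnit (n : A) := by simpa using (isUnit_iff_ne_zero.2 hn).map (algebraMap K A)
  obtain ⟨r, ⟨-, hr⟩, -⟩ := Polynomial.existsUnique_nilpotent_sub_and_aeval_eq_zero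
    (P := Polynomial.X ^ n - Polynomial.C a) (x := s) (by simpa using hs)
    (by simpa [Polynomial.derivative_X_pow] using hn_unit.mul (hs_unit.pow (n - 1)))
  exact ⟨r, sub_eq_zero.1 (by simpa using hr)⟩

theorem exists_mem_adjoin_pow_eq_of_isUnit {A : Type*} [Ring A] [Algebra K A] (hn : (n : K) ≠ 0)
    {a : A} (hi : IsIntegral K a) (ha : IsUnit a) : ∃ s ∈ Algebra.adjoin K {a}, s ^ n = a := by
  have : Module.Finite K (Algebra.adjoin K {a}) := Algebra.finite_adjoin_simple_of_isIntegral hi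
  have : IsArtinianRing (Algebra.adjoin K {a}) := isArtinian_of_tower K inferInstance
  let b : Algebra.adjoin K {a} := ⟨a, Algebra.self_mem_adjoin_singleton K a⟩
  have hb : IsUnit b := IsArtinianRing.isUnit_of_mem_nonZeroDivisors <|
    comap_nonZeroDivisors_le_of_injective (f := (Algebra.adjoin K {a}).subtype)
      Subtype.val_injective ha.mem_nonZeroDivisors
  obtain ⟨s, hs⟩ := exists_pow_eq_of_isUnit hn hb
  exact ⟨s, s.2, congrArg Subtype.val hs⟩

end NthRoot

section Adjoin

variable {R V : Type*} [CommRing R] [AddCommGroup V] [Module R V] {M T : Module.End R V}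

theorem apply_mem_of_mem_adjoin_singleton {p : Submodule R V} (hM : ∀ x ∈ p, M x ∈ p)
    (hT : T ∈ Algebra.adjoin R {M}) : ∀ x ∈ p, T x ∈ p := by
  induction hT using Algebra.adjoin_induction with
  | mem _ hS => rwa [Set.mem_singleton_iff.1 hS]
  | algebraMap r => exact fun x hx => p.smul_mem r hx
  | add S T _ _ hS hT => exact fun x hx => p.add_mem (hS x hx) (hT x hx)
  | mul _ T _ _ hS hT => exact fun x hx => hS _ (hT x hx)

theorem isAdjointPair_self_of_mem_adjoin_singleton {B : BilinForm R V}
    (hM : IsAdjointPair B B M M) (hT : T ∈ Algebra.adjoin R {M}) : IsAdjointPair B B T T := by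
  induction hT using Algebra.adjoin_induction with
  | mem _ hS => rwa [Set.mem_singleton_iff.1 hS]
  | algebraMap r => exact fun x y => by simp [Module.algebraMap_end_apply]
  | add S T _ _ hS hT => exact hS.add hT
  | mul S T hS' hT' hS hT =>
    have hcomm : Commute S T := Algebra.commute_of_mem_adjoin_singleton_of_commute hT'
      (Algebra.commute_of_mem_adjoin_self hS').symm
    have h : IsAdjointPair B B (S * T) (T * S) := hS.mul hT
    rwa [← hcomm.eq] at h

end Adjoin

theorem exists_smul_add_smul_eq_of_finrank_le_two {K V : Type*} [DivisionRing K] [AddCommGroup V]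
    [Module K V] {E : Submodule K V} [FiniteDimensional K E] (hE : Module.finrank K E ≤ 2)
    {u v : V} (hu : u ∈ E) (hv : v ∈ E) (huv : LinearIndependent K ![u, v]) {w : V} (hw : w ∈ E) :
    ∃ a b : K, a • u + b • v = w := by
  have hle : Submodule.span K (Set.range ![u, v]) ≤ E :=
    Submodule.span_le.2 (by rintro _ ⟨i, rfl⟩; fin_cases i <;> assumption)
  have hspan := Submodule.eq_of_le_of_finrank_le hle (by simpa [finrank_span_eq_card huv])
  rw [Matrix.range_cons_cons_empty] at hspan
  exact Submodule.mem_span_pair.1 (hspan ▸ hw)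

section Grading

variable {R V W : Type*} [CommRing R] [AddCommGroup V] [Module R V] [AddCommGroup W] [Module R W]

theorem homogeneous_induction {ι : Type*} [DecidableEq ι] {𝒱 : ι → Submodule R V}
    (h𝒱 : DirectSum.IsInternal 𝒱) {p : V → Prop} (zero : p 0) (hom : ∀ i, ∀ x ∈ 𝒱 i, p x)
    (add : ∀ x y, p x → p y → p (x + y)) (x : V) : p x :=
  Submodule.iSup_induction 𝒱 (motive := p) (h𝒱.submodule_iSup_eq_top ▸ Submodule.mem_top) hom zero
    add

theorem bilinearMap_ext_homogeneous {ι : Type*} [DecidableEq ι] {𝒱 : ι → Submodule R V}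
    (h𝒱 : DirectSum.IsInternal 𝒱) {β γ : V →ₗ[R] V →ₗ[R] W}
    (h : ∀ i j, ∀ x ∈ 𝒱 i, ∀ y ∈ 𝒱 j, β x y = γ x y) : β = γ := by
  ext x y
  induction x using homogeneous_induction h𝒱 with
  | zero => rw [map_zero, map_zero]
  | hom i x hx =>
    induction y using homogeneous_induction h𝒱 with
    | zero => rw [map_zero, map_zero]
    | hom j y hy => exact h i j x hx y hy
    | add y z hy hz => rw [map_add, map_add, hy, hz]
  | add x z hx hz => rw [map_add, map_add, LinearMap.add_apply, LinearMap.add_apply, hx, hz]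

theorem bilinearMap_ext_even_odd {𝒱 : ZMod 2 → Submodule R V} (h𝒱 : DirectSum.IsInternal 𝒱)
    {β γ : V →ₗ[R] V →ₗ[R] W} (h₀₀ : ∀ x ∈ 𝒱 0, ∀ y ∈ 𝒱 0, β x y = γ x y)
    (h₀₁ : ∀ x ∈ 𝒱 0, ∀ y ∈ 𝒱 1, β x y = γ x y) (h₁₀ : ∀ x ∈ 𝒱 1, ∀ y ∈ 𝒱 0, β x y = γ x y)
    (h₁₁ : ∀ x ∈ 𝒱 1, ∀ y ∈ 𝒱 1, β x y = γ x y) : β = γ :=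
  bilinearMap_ext_homogeneous h𝒱 (Fin.forall_fin_two.2
    ⟨Fin.forall_fin_two.2 ⟨h₀₀, h₀₁⟩, Fin.forall_fin_two.2 ⟨h₁₀, h₁₁⟩⟩)

theorem isCompl_add_one {𝒱 : ZMod 2 → Submodule R V} (h𝒱 : DirectSum.IsInternal 𝒱) (i : ZMod 2) :
    IsCompl (𝒱 i) (𝒱 (i + 1)) := by
  have hcases : ∀ i j : ZMod 2, j = i ∨ j = i + 1 := by decide
  exact h𝒱.isCompl (by simp) (by ext j; simpa using hcases i j)

theorem exists_linearMap_eq_on_even_odd {𝒱 : ZMod 2 → Submodule R V}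
    (h𝒱 : DirectSum.IsInternal 𝒱) (S T : V →ₗ[R] W) :
    ∃ f : V →ₗ[R] W, (∀ x ∈ 𝒱 0, f x = S x) ∧ ∀ x ∈ 𝒱 1, f x = T x := by
  have hcompl : IsCompl (𝒱 0) (𝒱 1) := isCompl_add_one h𝒱 0
  exact ⟨LinearMap.ofIsCompl hcompl (S.domRestrict (𝒱 0)) (T.domRestrict (𝒱 1)),
    fun x hx => LinearMap.ofIsCompl_apply_left hcompl ⟨x, hx⟩,
    fun x hx => LinearMap.ofIsCompl_apply_right hcompl ⟨x, hx⟩⟩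

end Grading

namespace LieSuperalgebra

variable {V : Type*} [AddCommGroup V] [Module ℂ V] {𝒱 : ZMod 2 → Submodule ℂ V}
  (g : LieSuperalgebra 𝒱)

section Bracket

variable {e f x y : V}

theorem bracket_skew_even_even (he : e ∈ 𝒱 0) (hf : f ∈ 𝒱 0) :
    g.bracket e f = -g.bracket f e := by
  simpa using g.bracket_skew 0 0 e he f hf

theorem bracket_skew_odd_even (hx : x ∈ 𝒱 1) (he : e ∈ 𝒱 0) :
    g.bracket x e = -g.bracket e x := by
  simpa using g.bracket_skew 1 0 x hx e he

theorem bracket_comm_odd_odd (hx : x ∈ 𝒱 1) (hy : y ∈ 𝒱 1) :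
    g.bracket x y = g.bracket y x := by
  simpa [ZMod.val_one] using g.bracket_skew 1 1 x hx y hy

theorem bracket_even_self (he : e ∈ 𝒱 0) : g.bracket e e = 0 :=
  have := IsAddTorsionFree.of_isTorsionFree ℂ V
  self_eq_neg.1 (g.bracket_skew_even_even he he)

theorem bracket_odd_odd_mem (hx : x ∈ 𝒱 1) (hy : y ∈ 𝒱 1) : g.bracket x y ∈ 𝒱 0 :=
  g.bracket_mem 1 1 x hx y hy

theorem bracket_bracket_odd_self (hx : x ∈ 𝒱 1) : g.bracket (g.bracket x x) x = 0 := by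
  have hjacobi := g.jacobi 1 1 1 x hx x hx x hx
  rw [g.bracket_skew_odd_even hx (g.bracket_odd_odd_mem hx hx)] at hjacobi
  have htriple : (3 : ℂ) • g.bracket (g.bracket x x) x = 0 := by
    simp only [ZMod.val_one, mul_one, pow_one] at hjacobi
    linear_combination (norm := module) -hjacobi
  exact (smul_eq_zero.1 htriple).resolve_left (by norm_num)

theorem bracket_odd_bracket_odd_odd {z : V} (hx : x ∈ 𝒱 1) (hy : y ∈ 𝒱 1) (hz : z ∈ 𝒱 1) :
    g.bracket x (g.bracket y z) =
      g.bracket (g.bracket x y) z + g.bracket (g.bracket x z) y := by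
  rw [g.jacobi 1 1 1 x hx y hy z hz, g.bracket_skew_odd_even hy (g.bracket_odd_odd_mem hx hz)]
  simp [ZMod.val_one]

theorem bracket_odd_odd_eq_zero_of_self (h : ∀ x ∈ 𝒱 1, g.bracket x x = 0) (hx : x ∈ 𝒱 1)
    (hy : y ∈ 𝒱 1) : g.bracket x y = 0 := by
  have hsum := h (x + y) (Submodule.add_mem _ hx hy)
  simp only [map_add, LinearMap.add_apply, h x hx, h y hy, g.bracket_comm_odd_odd hy hx] at hsum
  simpa [← two_smul ℂ] using hsum

end Bracket

/-- A bilinear form making the Lie superalgebra `g` quadratic. It is kept apart from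
`QuadraticLieSuperalgebra` so that several forms on the same bracket can be compared. -/
structure IsInvariantForm (B : BilinForm ℂ V) : Prop where
  nondegenerate : B.Nondegenerate
  even : ∀ i j, i ≠ j → ∀ x ∈ 𝒱 i, ∀ y ∈ 𝒱 j, B x y = 0
  supersymm : ∀ i j : ZMod 2, ∀ x ∈ 𝒱 i, ∀ y ∈ 𝒱 j, B x y = (-1 : ℂ) ^ (i.val * j.val) * B y x
  invariant : ∀ x y z, B (g.bracket x y) z = B x (g.bracket y z)

/-- A square root, within the centroid of `g`, of the endomorphism `N` determined by
`B x y = B' (N x) y`. It is an isometry from `B` to `B'`, but multiplies brackets by `N`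
rather than preserving them. -/
structure IsCentroidIsometry (B B' : BilinForm ℂ V) (R : Module.End ℂ V) : Prop where
  map_mem : ∀ i, ∀ x ∈ 𝒱 i, R x ∈ 𝒱 i
  isometry : ∀ x y, B' (R x) (R y) = B x y
  isAdjointPair : IsAdjointPair B' B' R R
  map_bracket_left : ∀ x y, R (g.bracket x y) = g.bracket (R x) y
  map_bracket_right : ∀ x y, R (g.bracket x y) = g.bracket x (R y)

namespace IsInvariantForm

variable {g} {B B' : BilinForm ℂ V}

section Orthogonality

variable (hB : g.IsInvariantForm B)

include hB

theorem ext_left {x y : V} (h : ∀ z, B x z = B y z) : x = y :=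
  sub_eq_zero.1 <| hB.nondegenerate.1 _ fun z => by rw [map_sub, LinearMap.sub_apply, h, sub_self]

theorem symm_even {e f : V} (he : e ∈ 𝒱 0) (hf : f ∈ 𝒱 0) : B e f = B f e := by
  simpa using hB.supersymm 0 0 e he f hf

theorem eq_zero_of_forall_mem {i : ZMod 2} {x : V} (hx : x ∈ 𝒱 i) (h : ∀ y ∈ 𝒱 i, B x y = 0) :
    x = 0 := by
  refine hB.nondegenerate.1 x fun y => ?_
  induction y using homogeneous_induction g.isInternal with
  | zero => exact map_zero _
  | hom j y hy =>
    obtain rfl | hij := eq_or_ne i j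
    · exact h y hy
    · exact hB.even i j hij x hx y hy
  | add y z hy hz => rw [map_add, hy, hz, add_zero]

theorem mem_of_forall_ne {i : ZMod 2} {x : V} (h : ∀ j ≠ i, ∀ y ∈ 𝒱 j, B x y = 0) : x ∈ 𝒱 i := by
  have hi : i + 1 ≠ i := by simp
  obtain ⟨u, hu, v, hv, rfl⟩ := Submodule.mem_sup.1
    ((isCompl_add_one g.isInternal i).sup_eq_top ▸ Submodule.mem_top (x := x))
  have hv₀ : v = 0 := hB.eq_zero_of_forall_mem hv fun y hy => by
    simpa [hB.even i (i + 1) hi.symm u hu y hy] using h (i + 1) hi y hy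
  rwa [hv₀, add_zero]

end Orthogonality

section CentroidIsometry

variable {N : Module.End ℂ V} (hB : g.IsInvariantForm B) (hB' : g.IsInvariantForm B')
  (hN : ∀ x y, B' (N x) y = B x y)

include hB hB' hN

theorem formChange_mem (i : ZMod 2) : ∀ x ∈ 𝒱 i, N x ∈ 𝒱 i := fun x hx =>
  hB'.mem_of_forall_ne fun j hj y hy => by rw [hN, hB.even i j hj.symm x hx y hy]

theorem isAdjointPair_formChange : IsAdjointPair B' B' N N := by
  have h : B' ∘ₗ N = B'.compl₂ N := bilinearMap_ext_homogeneous g.isInternal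
    fun i j x hx y hy => calc
      B' (N x) y = B x y := hN x y
      _ = (-1 : ℂ) ^ (i.val * j.val) * B' (N y) x := by rw [hN, hB.supersymm i j x hx y hy]
      _ = B' x (N y) := (hB'.supersymm i j x hx _ (formChange_mem hB hB' hN j y hy)).symm
  exact LinearMap.congr_fun₂ h

theorem formChange_bracket_left (x y : V) : N (g.bracket x y) = g.bracket (N x) y :=
  hB'.ext_left fun z => by rw [hN, hB.invariant, ← hN, hB'.invariant]

theorem formChange_bracket_right (x y : V) : N (g.bracket x y) = g.bracket x (N y) := by
  have hadj := isAdjointPair_formChange hB hB' hN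
  refine hB'.ext_left fun z => ?_
  calc
    B' (N (g.bracket x y)) z = B' (N x) (g.bracket y z) := by rw [hN, hN, hB.invariant]
    _ = B' x (N (g.bracket y z)) := hadj x _
    _ = B' x (g.bracket (N y) z) := by rw [formChange_bracket_left hB hB' hN]
    _ = B' (g.bracket x (N y)) z := (hB'.invariant _ _ _).symm

end CentroidIsometry

theorem exists_isCentroidIsometry [FiniteDimensional ℂ V] (hB : g.IsInvariantForm B)
    (hB' : g.IsInvariantForm B') : ∃ R, g.IsCentroidIsometry B B' R := by
  let N : Module.End ℂ V := B.symmCompOfNondegenerate B' hB'.nondegenerate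
  have hN (x y : V) : B' (N x) y = B x y := B.symmCompOfNondegenerate_left_apply _ y x
  have hN_inj : Function.Injective N := fun x y hxy =>
    hB.ext_left fun z => by rw [← hN, ← hN, hxy]
  have hN_unit : IsUnit N := (Module.End.isUnit_iff N).2
    ⟨hN_inj, LinearMap.injective_iff_surjective.1 hN_inj⟩
  obtain ⟨R, hR, hR_sq⟩ := exists_mem_adjoin_pow_eq_of_isUnit (K := ℂ) (n := 2) (by norm_num)
    (Algebra.IsIntegral.isIntegral N) hN_unit
  have hadj : IsAdjointPair B' B' R R :=
    isAdjointPair_self_of_mem_adjoin_singleton (isAdjointPair_formChange hB hB' hN) hR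
  have hcomm {T : Module.End ℂ V} (hT : ∀ y, N (T y) = T (N y)) (y : V) : R (T y) = T (R y) :=
    (LinearMap.congr_fun (Algebra.commute_of_mem_adjoin_singleton_of_commute hR
      (LinearMap.ext fun y => (hT y).symm : Commute T N)) y).symm
  exact ⟨R,
    { map_mem := fun i =>
        apply_mem_of_mem_adjoin_singleton (formChange_mem hB hB' hN i) hR
      isometry := fun x y => by
        rw [← hadj, ← hN, ← hR_sq, pow_two, Module.End.mul_apply]
      isAdjointPair := hadj
      map_bracket_left := fun x y => hcomm (T := g.bracket.flip y)
        (fun x => formChange_bracket_left hB hB' hN x y) x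
      map_bracket_right := fun x y => hcomm (formChange_bracket_right hB hB' hN x) y }⟩

section TwoDimensionalEvenPart

variable [FiniteDimensional ℂ (𝒱 0)] (hB : g.IsInvariantForm B)
  (hdim : Module.finrank ℂ (𝒱 0) ≤ 2)

include hB hdim

theorem eq_zero_of_orthogonal_pair {u v w : V} (hu : u ∈ 𝒱 0) (hv : v ∈ 𝒱 0)
    (huv : LinearIndependent ℂ ![u, v]) (hw : w ∈ 𝒱 0) (hwu : B w u = 0) (hwv : B w v = 0) :
    w = 0 :=
  hB.eq_zero_of_forall_mem hw fun y hy => by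
    obtain ⟨a, b, rfl⟩ := exists_smul_add_smul_eq_of_finrank_le_two hdim hu hv huv hy
    simp [hwu, hwv]

theorem exists_smul_eq_of_isotropic {X v : V} (hX : X ∈ 𝒱 0) (hX₀ : X ≠ 0) (hXX : B X X = 0)
    (hv : v ∈ 𝒱 0) (hXv : B X v = 0) : ∃ c : ℂ, c • X = v := by
  by_contra! h
  exact hX₀ (hB.eq_zero_of_orthogonal_pair hdim hX hv ((LinearIndependent.pair_iff' hX₀).2 h)
    hX hXX hXv)

theorem bracket_even_even_eq_zero {e f : V} (he : e ∈ 𝒱 0) (hf : f ∈ 𝒱 0) :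
    g.bracket e f = 0 := by
  by_cases hef : LinearIndependent ℂ ![e, f]
  · refine hB.eq_zero_of_orthogonal_pair hdim he hf hef (g.bracket_mem 0 0 e he f hf) ?_ ?_
    · rw [g.bracket_skew_even_even he hf, map_neg, LinearMap.neg_apply, hB.invariant,
        g.bracket_even_self he, map_zero, neg_zero]
    · rw [hB.invariant, g.bracket_even_self hf, map_zero]
  · obtain rfl | he₀ := eq_or_ne e 0
    · rw [map_zero, LinearMap.zero_apply]
    · rw [LinearIndependent.pair_iff' he₀] at hef
      push Not at hef
      obtain ⟨a, rfl⟩ := hef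
      rw [map_smul, g.bracket_even_self he, smul_zero]

theorem bracket_eq_zero_of_odd_odd (h : ∀ x ∈ 𝒱 1, ∀ y ∈ 𝒱 1, g.bracket x y = 0) :
    g.bracket = 0 := by
  have h₀₁ : ∀ e ∈ 𝒱 0, ∀ x ∈ 𝒱 1, g.bracket e x = 0 := fun e he x hx =>
    hB.eq_zero_of_forall_mem (g.bracket_mem 0 1 e he x hx) fun y hy => by
      rw [zero_add] at hy
      rw [hB.invariant, h x hx y hy, map_zero]
  exact bilinearMap_ext_even_odd g.isInternal
    (fun e he f hf => hB.bracket_even_even_eq_zero hdim he hf) h₀₁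
    (fun x hx e he => by simp [g.bracket_skew_odd_even hx he, h₀₁ e he x hx]) h

section OddSquare

variable {x₀ : V} (hx₀ : x₀ ∈ 𝒱 1) (hX₀ : g.bracket x₀ x₀ ≠ 0)

include hx₀

omit [FiniteDimensional ℂ (𝒱 0)] hdim in
theorem form_bracket_self_bracket (y : V) :
    B (g.bracket x₀ x₀) (g.bracket x₀ y) = 0 := by
  rw [← hB.invariant, g.bracket_bracket_odd_self hx₀, map_zero, LinearMap.zero_apply]

include hX₀

theorem form_bracket_self_bracket_odd_odd {x y : V} (hx : x ∈ 𝒱 1) (hy : y ∈ 𝒱 1) :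
    B (g.bracket x₀ x₀) (g.bracket x y) = 0 := by
  have hX := g.bracket_odd_odd_mem hx₀ hx₀
  have hspan {z : V} (hz : z ∈ 𝒱 1) : ∃ c : ℂ, c • g.bracket x₀ x₀ = g.bracket x₀ z :=
    hB.exists_smul_eq_of_isotropic hdim hX hX₀ (hB.form_bracket_self_bracket hx₀ x₀)
      (g.bracket_odd_odd_mem hx₀ hz) (hB.form_bracket_self_bracket hx₀ z)
  have horth (z : V) : B x₀ (g.bracket (g.bracket x₀ x₀) z) = 0 := by
    rw [← hB.invariant, g.bracket_skew_odd_even hx₀ hX, g.bracket_bracket_odd_self hx₀, neg_zero,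
      map_zero, LinearMap.zero_apply]
  obtain ⟨c, hc⟩ := hspan hx
  obtain ⟨d, hd⟩ := hspan hy
  rw [hB.invariant, g.bracket_odd_bracket_odd_odd hx₀ hx hy, ← hc, ← hd]
  simp [horth]

theorem exists_smul_bracket_self_eq_bracket {x y : V} (hx : x ∈ 𝒱 1) (hy : y ∈ 𝒱 1) :
    ∃ c : ℂ, c • g.bracket x₀ x₀ = g.bracket x y :=
  hB.exists_smul_eq_of_isotropic hdim (g.bracket_odd_odd_mem hx₀ hx₀) hX₀
    (hB.form_bracket_self_bracket hx₀ x₀) (g.bracket_odd_odd_mem hx hy)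
    (hB.form_bracket_self_bracket_odd_odd hdim hx₀ hX₀ hx hy)

theorem bracket_bracket_self_odd_eq_zero {x : V} (hx : x ∈ 𝒱 1) :
    g.bracket (g.bracket x₀ x₀) x = 0 := by
  have hX := g.bracket_odd_odd_mem hx₀ hx₀
  refine hB.eq_zero_of_forall_mem (g.bracket_mem 0 1 _ hX x hx) fun y hy => ?_
  rw [zero_add] at hy
  rw [hB.invariant, hB.form_bracket_self_bracket_odd_odd hdim hx₀ hX₀ hx hy]

end OddSquare

theorem exists_hyperbolic_partner {X : V} (hX : X ∈ 𝒱 0) (hX₀ : X ≠ 0) (hXX : B X X = 0) :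
    ∃ Y ∈ 𝒱 0, B X Y = 1 ∧ ∀ e ∈ 𝒱 0, B X e • Y + B Y e • X = e := by
  obtain ⟨Z, hZ, hXZ⟩ : ∃ Z ∈ 𝒱 0, B X Z ≠ 0 := by
    by_contra! h
    exact hX₀ (hB.eq_zero_of_forall_mem hX h)
  obtain ⟨U, hU, hXU⟩ : ∃ U ∈ 𝒱 0, B X U = 1 :=
    ⟨(B X Z)⁻¹ • Z, Submodule.smul_mem _ _ hZ, by simp [hXZ]⟩
  let Y := U - (B U U / 2) • X
  have hY : Y ∈ 𝒱 0 := Submodule.sub_mem _ hU (Submodule.smul_mem _ _ hX)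
  have hUX : B U X = 1 := by rw [hB.symm_even hU hX, hXU]
  have hXY : B X Y = 1 := by simp [Y, hXU, hXX]
  have hYX : B Y X = 1 := by rw [hB.symm_even hY hX, hXY]
  have hYY : B Y Y = 0 := by
    simp only [Y, map_sub, map_smul, LinearMap.sub_apply, LinearMap.smul_apply, smul_eq_mul, hUX,
      hXU, hXX]
    ring
  refine ⟨Y, hY, hXY, fun e he => ?_⟩
  obtain ⟨c, hc⟩ := hB.exists_smul_eq_of_isotropic hdim hX hX₀ hXX
    (Submodule.sub_mem _ he (Submodule.smul_mem _ (B X e) hY)) (by simp [hXY])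
  have hYe : c = B Y e := by simpa [hYX, hYY] using congrArg (B Y) hc
  rw [← hYe, hc, add_sub_cancel]

theorem exists_even_isometry (hB' : g.IsInvariantForm B') {X : V} (hX : X ∈ 𝒱 0) (hX₀ : X ≠ 0)
    (hXX : B X X = 0) {μ : ℂ} (hμ : ∀ z, B X z = μ * B' X z) :
    ∃ ψ : Module.End ℂ V, ψ X = μ • X ∧ (∀ e ∈ 𝒱 0, ∃ c : ℂ, ψ e = e + c • X) ∧
      ∀ e ∈ 𝒱 0, ∀ f ∈ 𝒱 0, B' (ψ e) (ψ f) = B e f := by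
  obtain ⟨Y, hY, hXY, hdecomp⟩ := hB.exists_hyperbolic_partner hdim hX hX₀ hXX
  have hYX : B Y X = 1 := by rw [hB.symm_even hY hX, hXY]
  have hμXY : μ * B' X Y = 1 := by rw [← hμ, hXY]
  have hμ₀ : μ ≠ 0 := left_ne_zero_of_mul_eq_one hμXY
  have hXX' : B' X X = 0 := by simpa [hXX, hμ₀] using hμ X
  -- This value of `b` makes `Y + b • X` isotropic for `B'`.
  let b : ℂ := -μ * B' Y Y / 2
  let ψ : Module.End ℂ V := (B X).smulRight (Y + b • X) + (μ • B Y).smulRight X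
  have hψ (e : V) : ψ e = B X e • (Y + b • X) + (μ * B Y e) • X := rfl
  refine ⟨ψ, by simp [hψ, hXX, hYX], fun e he => ?_, fun e he f _ => ?_⟩
  · refine ⟨B X e * b + μ * B Y e - B Y e, ?_⟩
    rw [hψ]
    linear_combination (norm := module) hdecomp e he
  · have hBef : B e f = B X e * B Y f + B Y e * B X f := by
      nth_rw 1 [← hdecomp e he]
      simp [mul_comm]
    simp only [hψ, hBef, map_add, map_smul, LinearMap.add_apply, LinearMap.smul_apply, smul_eq_mul,
      hB'.symm_even hY hX, hXX', b]
    linear_combination (B X e * B Y f + B Y e * B X f - B X e * B X f * B' Y Y) * hμXY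

end TwoDimensionalEvenPart

theorem exists_iso_of_isometry [FiniteDimensional ℂ V] (hB : g.IsInvariantForm B)
    {f : Module.End ℂ V} (map_mem : ∀ i, ∀ x ∈ 𝒱 i, f x ∈ 𝒱 i)
    (map_bracket : ∀ x y, f (g.bracket x y) = g.bracket (f x) (f y))
    (isometry : ∀ x y, B' (f x) (f y) = B x y) :
    ∃ A : g.Iso g, ∀ x y, B' (A.toLinearEquiv x) (A.toLinearEquiv y) = B x y := by
  have hf : Function.Injective f := fun x y hxy =>
    hB.ext_left fun z => by rw [← isometry, ← isometry, hxy]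
  exact ⟨{ toLinearEquiv := LinearEquiv.ofInjectiveEndo f hf, map_mem, map_bracket }, isometry⟩

theorem isometry_of_even_odd (hB : g.IsInvariantForm B) (hB' : g.IsInvariantForm B')
    {f : Module.End ℂ V} (map_mem : ∀ i, ∀ x ∈ 𝒱 i, f x ∈ 𝒱 i)
    (h₀ : ∀ x ∈ 𝒱 0, ∀ y ∈ 𝒱 0, B' (f x) (f y) = B x y)
    (h₁ : ∀ x ∈ 𝒱 1, ∀ y ∈ 𝒱 1, B' (f x) (f y) = B x y) (x y : V) :
    B' (f x) (f y) = B x y := by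
  have hne {i j : ZMod 2} (hij : i ≠ j) (x : V) (hx : x ∈ 𝒱 i) (y : V) (hy : y ∈ 𝒱 j) :
      B' (f x) (f y) = B x y := by
    rw [hB.even i j hij x hx y hy, hB'.even i j hij _ (map_mem i x hx) _ (map_mem j y hy)]
  exact LinearMap.congr_fun₂ (bilinearMap_ext_even_odd g.isInternal (β := B'.compl₁₂ f f) h₀
    (hne zero_ne_one) (hne one_ne_zero) h₁) x y

end IsInvariantForm

namespace IsCentroidIsometry

variable {g} {B B' : BilinForm ℂ V} {R : Module.End ℂ V} (hR : g.IsCentroidIsometry B B' R)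

include hR

theorem bracket_map_map (x y : V) : g.bracket (R x) (R y) = R (R (g.bracket x y)) := by
  rw [hR.map_bracket_left, hR.map_bracket_right]

theorem form_eq_sq_mul {X : V} {κ : ℂ} (hX : R X = κ • X) (z : V) : B X z = κ ^ 2 * B' X z := calc
  B X z = B' (R X) (R z) := (hR.isometry X z).symm
  _ = κ * B' (R X) z := by
    rw [hR.isAdjointPair X z, hX, map_smul, LinearMap.smul_apply, smul_eq_mul]
  _ = κ ^ 2 * B' X z := by rw [hX, map_smul, LinearMap.smul_apply, smul_eq_mul, pow_two, mul_assoc]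

theorem map_bracket_of_eq_on_odd {f : Module.End ℂ V} {X : V} {κ : ℂ}
    (h₀₀ : ∀ e ∈ 𝒱 0, ∀ e' ∈ 𝒱 0, g.bracket e e' = 0)
    (hX : ∀ x ∈ 𝒱 1, g.bracket X x = 0)
    (hline : ∀ x ∈ 𝒱 1, ∀ y ∈ 𝒱 1, ∃ c : ℂ, c • X = g.bracket x y)
    (hRX : R X = κ • X) (hfX : f X = κ ^ 2 • X) (hf_mem : ∀ i, ∀ x ∈ 𝒱 i, f x ∈ 𝒱 i)
    (hf₀ : ∀ e ∈ 𝒱 0, ∃ c : ℂ, f e = e + c • X) (hf₁ : ∀ x ∈ 𝒱 1, f x = R x) (x y : V) :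
    f (g.bracket x y) = g.bracket (f x) (f y) := by
  have h₀₁ : ∀ e ∈ 𝒱 0, ∀ x ∈ 𝒱 1, f (g.bracket e x) = g.bracket (f e) (f x) := by
    intro e he x hx
    obtain ⟨c, hc⟩ := hf₀ e he
    rw [hf₁ _ (g.bracket_mem 0 1 e he x hx), hc, map_add, LinearMap.add_apply, map_smul,
      LinearMap.smul_apply, hX _ (hf_mem 1 x hx), smul_zero, add_zero, hf₁ x hx,
      hR.map_bracket_right]
  refine LinearMap.congr_fun₂ (bilinearMap_ext_even_odd g.isInternal
    (β := g.bracket.compr₂ f) (γ := g.bracket.compl₁₂ f f) ?_ h₀₁ ?_ ?_) x y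
  · intro e he e' he'
    simp [h₀₀ e he e' he', h₀₀ _ (hf_mem 0 e he) _ (hf_mem 0 e' he')]
  · intro x hx e he
    simp [g.bracket_skew_odd_even hx he, h₀₁ e he x hx,
      g.bracket_skew_odd_even (hf_mem 1 x hx) (hf_mem 0 e he)]
  · intro x hx y hy
    obtain ⟨c, hc⟩ := hline x hx y hy
    simp [hf₁ x hx, hf₁ y hy, hR.bracket_map_map, ← hc, hfX, hRX, smul_smul, pow_two, mul_assoc]

end IsCentroidIsometry

namespace IsInvariantForm

variable {g} {B B' : BilinForm ℂ V} {R : Module.End ℂ V} [FiniteDimensional ℂ V]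
  (hB : g.IsInvariantForm B) (hB' : g.IsInvariantForm B')
  (hdim : Module.finrank ℂ (𝒱 0) ≤ 2)

include hB hB' hdim

theorem exists_automorphism_of_bracket_self_ne_zero (hR : g.IsCentroidIsometry B B' R) {x₀ : V}
    (hx₀ : x₀ ∈ 𝒱 1) (hX₀ : g.bracket x₀ x₀ ≠ 0) :
    ∃ A : g.Iso g, ∀ x y, B' (A.toLinearEquiv x) (A.toLinearEquiv y) = B x y := by
  set X := g.bracket x₀ x₀ with hX_def
  have hX : X ∈ 𝒱 0 := g.bracket_odd_odd_mem hx₀ hx₀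
  have hline : ∀ x ∈ 𝒱 1, ∀ y ∈ 𝒱 1, ∃ c : ℂ, c • X = g.bracket x y := fun x hx y hy =>
    hB.exists_smul_bracket_self_eq_bracket hdim hx₀ hX₀ hx hy
  obtain ⟨κ, hκ⟩ := hline (R x₀) (hR.map_mem 1 x₀ hx₀) x₀ hx₀
  have hRX : R X = κ • X := by rw [hκ, hX_def, hR.map_bracket_left]
  obtain ⟨ψ, hψX, hψ, hψ_isometry⟩ := hB.exists_even_isometry hdim hB' hX hX₀
    (hB.form_bracket_self_bracket hx₀ x₀) (hR.form_eq_sq_mul hRX)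
  obtain ⟨f, hf₀, hf₁⟩ := exists_linearMap_eq_on_even_odd g.isInternal ψ R
  have hf_even : ∀ e ∈ 𝒱 0, ∃ c : ℂ, f e = e + c • X := fun e he => hf₀ e he ▸ hψ e he
  have hf_mem : ∀ i, ∀ x ∈ 𝒱 i, f x ∈ 𝒱 i := by
    refine Fin.forall_fin_two.2 ⟨fun e he => ?_, fun x hx => hf₁ x hx ▸ hR.map_mem 1 x hx⟩
    obtain ⟨c, hc⟩ := hf_even e he
    exact hc ▸ Submodule.add_mem _ he (Submodule.smul_mem _ c hX)
  refine hB.exists_iso_of_isometry hf_mem ?_ (isometry_of_even_odd hB hB' hf_mem ?_ ?_)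
  · exact hR.map_bracket_of_eq_on_odd (fun e he e' he' => hB.bracket_even_even_eq_zero hdim he he')
      (fun x hx => hB.bracket_bracket_self_odd_eq_zero hdim hx₀ hX₀ hx) hline hRX
      (hf₀ X hX ▸ hψX) hf_mem hf_even hf₁
  · exact fun e he e' he' => by rw [hf₀ e he, hf₀ e' he', hψ_isometry e he e' he']
  · exact fun x hx y hy => by rw [hf₁ x hx, hf₁ y hy, hR.isometry]

theorem exists_automorphism :
    ∃ A : g.Iso g, ∀ x y, B' (A.toLinearEquiv x) (A.toLinearEquiv y) = B x y := by
  obtain ⟨R, hR⟩ := hB.exists_isCentroidIsometry hB'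
  by_cases h : ∀ x ∈ 𝒱 1, g.bracket x x = 0
  · have hzero : g.bracket = 0 := hB.bracket_eq_zero_of_odd_odd hdim fun x hx y hy =>
      g.bracket_odd_odd_eq_zero_of_self h hx hy
    exact hB.exists_iso_of_isometry hR.map_mem (by simp [hzero]) hR.isometry
  · push Not at h
    obtain ⟨x₀, hx₀, hX₀⟩ := h
    exact hB.exists_automorphism_of_bracket_self_ne_zero hB' hdim hR hx₀ hX₀

end IsInvariantForm

section Iso

variable {g} {W : Type*} [AddCommGroup W] [Module ℂ W] {𝒲 : ZMod 2 → Submodule ℂ W}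
  {g' : LieSuperalgebra 𝒲}

theorem IsInvariantForm.pullback {B : BilinForm ℂ W} (hB : g'.IsInvariantForm B) (A : g.Iso g') :
    g.IsInvariantForm (B.compl₁₂ A.toLinearEquiv.toLinearMap A.toLinearEquiv.toLinearMap) where
  nondegenerate := by
    refine ⟨fun x hx => ?_, fun x hx => ?_⟩
    · refine A.toLinearEquiv.map_eq_zero_iff.1 (hB.nondegenerate.1 _ fun y => ?_)
      simpa using hx (A.toLinearEquiv.symm y)
    · refine A.toLinearEquiv.map_eq_zero_iff.1 (hB.nondegenerate.2 _ fun y => ?_)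
      simpa using hx (A.toLinearEquiv.symm y)
  even i j hij x hx y hy := hB.even i j hij _ (A.map_mem i x hx) _ (A.map_mem j y hy)
  supersymm i j x hx y hy := hB.supersymm i j _ (A.map_mem i x hx) _ (A.map_mem j y hy)
  invariant x y z := by simp [A.map_bracket, hB.invariant]

/-- The composite of two isomorphisms of Lie superalgebras, the first one applied first. -/
def Iso.trans {U : Type*} [AddCommGroup U] [Module ℂ U] {𝒰 : ZMod 2 → Submodule ℂ U}
    {g'' : LieSuperalgebra 𝒰} (A : g.Iso g') (A' : g'.Iso g'') : g.Iso g'' where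
  toLinearEquiv := A.toLinearEquiv.trans A'.toLinearEquiv
  map_mem i x hx := A'.map_mem i _ (A.map_mem i x hx)
  map_bracket x y := by simp [A.map_bracket, A'.map_bracket]

end Iso

end LieSuperalgebra

theorem QuadraticLieSuperalgebra.isInvariantForm {V : Type*} [AddCommGroup V] [Module ℂ V]
    {𝒱 : ZMod 2 → Submodule ℂ V} (g : QuadraticLieSuperalgebra 𝒱) :
    g.toLieSuperalgebra.IsInvariantForm g.form where
  nondegenerate := g.form_nondegenerate
  even := g.form_even
  supersymm := g.form_supersymm
  invariant := g.form_invariant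

theorem finrank_stdGrading_zero (n : ℕ) : Module.finrank ℂ (stdGrading n 0) = 2 := by
  rw [stdGrading, if_pos rfl, LinearMap.finrank_range_of_inj LinearMap.inl_injective,
    Module.finrank_fin_fun]

theorem proposition3p4p13_general {V W : Type*} [AddCommGroup V] [Module ℂ V]
    [FiniteDimensional ℂ V] [AddCommGroup W] [Module ℂ W] {𝒱 : ZMod 2 → Submodule ℂ V}
    {𝒲 : ZMod 2 → Submodule ℂ W} (hdim : Module.finrank ℂ (𝒱 0) ≤ 2)
    (g : QuadraticLieSuperalgebra 𝒱) (g' : QuadraticLieSuperalgebra 𝒲) :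
    g.IsIsometricallyIsomorphic g' ↔ g.IsIsomorphic g' := by
  refine ⟨fun ⟨A, _⟩ => ⟨A⟩, fun ⟨A⟩ => ?_⟩
  obtain ⟨φ, hφ⟩ := g.isInvariantForm.exists_automorphism (g'.isInvariantForm.pullback A) hdim
  exact ⟨φ.trans A, hφ⟩

theorem proposition3p4p13 (n : ℕ) (g g' : QuadraticStructures n) :
    g.IsIsometricallyIsomorphic g' ↔ g.IsIsomorphic g' :=
  proposition3p4p13_general (finrank_stdGrading_zero n).le g g'
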